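/- **Setting.** Relays are placed one after the other along a half-line that starts at a sink (node $0$) and is discretized into steps of length $\delta>0$. Fix integers $A\ge 0$, $B\ge 1$, a finite nonempty set $\mathcal S$ of nonnegative transmit powers, and multipliers $\xi_{out},\xi_{relay}\ge 0$. Over a link of $u$ steps, with transmit power $\gamma$, shadowing $w$ and fading $H$ (a nonnegative random variable of given law), the received power is $\gamma\, c\,(u\delta/r_0)^{-\eta}\,w\,H$ with constants $c,r_0,\eta>0$; the outage probability is $Q_{out}(u,\gamma,w)=\mathbb P\big(\gamma\, c\,(u\delta/r_0)^{-\eta}\,w\,H\le P_{\min}\big)$, where $P_{\min}>0$ is fixed. The shadowing takes values in a Borel set $\mathcal W\subseteq(0,\infty)$ (for instance a finite one), has a given law on $\mathcal W$, and is independent and identically distributed across links. In the explore-forward approach, after placing a node the agent measures the shadowing values $\underline w=(w_{A+1},\dots,w_{A+B})$ of the links from the locations at distance $A+1,\dots,A+B$ steps to that node. Then he takes an action $(u,\gamma)\in\{A+1,\dots,A+B\}\times\mathcal S$: the next relay is placed $u$ steps from that node and uses transmit power $\gamma$, at the hop-cost $\gamma+\xi_{out}Q_{out}(u,\gamma,w_u)+\xi_{relay}$.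 The states $\underline w$ at successive decision instants are i.i.d. A policy $\pi$ prescribes, at each decision instant, an action (possibly at random) as a measurable function of the past states and actions and the current state. Let $N_x$ be the number of relays placed within $x$ steps of the sink and, for the $i$-th relay, let $\Gamma_i$ be its power and $Q_{out}^{(i,i-1)}$ the outage probability of its link to the previous node. The average cost per step of $\pi$ is $$\lambda_\pi=\limsup_{x\to\infty}\frac1x\,\mathbb E_\pi\sum_{i=1}^{N_x}\big(\Gamma_i+\xi_{out}Q_{out}^{(i,i-1)}+\xi_{relay}\big),$$ and the optimal average cost per step is $\lambda^*=\inf_\pi\lambda_\pi$, over all policies. **Theorem 3.** The number $\lambda^*$ is finite, and the OptExploreLim policy for $\lambda^*$ is optimal for the average cost per step problem. That is, there is a measurable map $\mu^*$ from states to actions with $$\mu^*(\underline w)\in\operatorname*{argmin}_{(u,\gamma)\in\{A+1,\dots,A+B\}\times\mathcal S}\big(\gamma+\xi_{out}Q_{out}(u,\gamma,w_u)+\xi_{relay}-\lambda^*u\big)\quad\text{for every state }\underline w,$$ and for every such $\mu^*$ the stationary policy that takes the action $\mu^*(\underline w)$ in each state $\underline w$ has average cost per step $\lambda^*$. -/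

import Mathlib

open MeasureTheory ProbabilityTheory Filter

noncomputable section

/-- The data of an explore-forward deployment problem along a line that starts at the sink and is
discretized into steps. After placing a node the agent measures the shadowing (towards that node)
at the `B` locations at distance `A + 1, …, A + B` steps from it, and then places the next relay at
one of these locations, choosing also its transmit power. -/
structure ExploreForward where
  /-- number of locations skipped after each placed node -/
  A : ℕ
  /-- number of locations explored after each placed node -/
  B : ℕ
  B_pos : 0 < B
  /-- the finite set of available transmit powers -/
  powers : Finset ℝ
  powers_nonempty : powers.Nonempty
  powers_nonneg : ∀ p ∈ powers, 0 ≤ p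
  /-- the length of one step -/
  stepLength : ℝ
  stepLength_pos : 0 < stepLength
  /-- the path-loss at the reference distance -/
  refLoss : ℝ
  refLoss_pos : 0 < refLoss
  /-- the reference distance -/
  refDist : ℝ
  refDist_pos : 0 < refDist
  /-- the path-loss exponent -/
  pathLossExp : ℝ
  pathLossExp_pos : 0 < pathLossExp
  /-- received power at or below this level means outage -/
  minRcvPower : ℝ
  minRcvPower_pos : 0 < minRcvPower
  /-- the law of the fading random variable `H` -/
  fadingLaw : Measure ℝ
  fadingLaw_prob : IsProbabilityMeasure fadingLaw
  fadingLaw_nonneg : ∀ᵐ h ∂fadingLaw, 0 ≤ h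
  /-- the set in which the shadowing random variable `W` takes its values: a Borel set of positive
  reals, for instance a finite one -/
  shadowSet : Set ℝ
  shadowSet_measurable : MeasurableSet shadowSet
  shadowSet_pos : ∀ w ∈ shadowSet, 0 < w
  /-- the law of the shadowing random variable `W` of a link -/
  shadowLaw : Measure shadowSet
  shadowLaw_prob : IsProbabilityMeasure shadowLaw
  /-- cost multiplier of the outage probability -/
  xiOut : ℝ
  xiOut_nonneg : 0 ≤ xiOut
  /-- cost of placing a relay -/
  xiRelay : ℝ
  xiRelay_nonneg : 0 ≤ xiRelay

namespace ExploreForward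

attribute [instance] fadingLaw_prob shadowLaw_prob

variable (D : ExploreForward)

/-- The candidate placement distances `A + 1, …, A + B` from the previous node, in steps. -/
abbrev Loc : Type := ↥(Finset.Icc (D.A + 1) (D.A + D.B))

/-- The states: vectors `(w_{A+1}, …, w_{A+B})` of measured shadowing values. -/
abbrev State : Type := D.Loc → D.shadowSet

/-- The actions: pairs of a placement distance and a transmit power. -/
abbrev Action : Type := D.Loc × ↥D.powers

/-- The received power `γ c (r / r₀) ^ (-η) w h` over a link of `u` steps (of length `r = u δ`),
with transmit power `γ`, shadowing `w` and fading `h`. -/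
def rcvPower (u : ℕ) (γ w h : ℝ) : ℝ :=
  γ * D.refLoss * (u * D.stepLength / D.refDist) ^ (-D.pathLossExp) * w * h

/-- The outage probability of a link of `u` steps, with transmit power `γ` and shadowing `w`. -/
def outage (u : ℕ) (γ w : ℝ) : ℝ :=
  D.fadingLaw.real {h | D.rcvPower u γ w h ≤ D.minRcvPower}

variable {D} in
/-- The hop length, in steps, of an action. -/
def hopLength (a : D.Action) : ℕ := a.1

variable {D} in
/-- The hop cost `γ + ξ_out Q_out(u, γ, w_u) + ξ_relay` of the action `(u, γ)` in the state `w`. -/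
def hopCost (w : D.State) (a : D.Action) : ℝ :=
  a.2 + D.xiOut * D.outage a.1 a.2 (w a.1) + D.xiRelay

/-- The law of the state at each decision instant: shadowing is i.i.d. across links. -/
def stateLaw : Measure D.State := Measure.pi fun _ => D.shadowLaw

instance : IsProbabilityMeasure D.stateLaw := by
  unfold stateLaw; infer_instance

/-- A general (history-dependent, randomized) placement policy. At the decision instant `k`
(`k = 0, 1, …`), the kernel `rule k` gives the law of the action to be taken, as a function of all
previous states and actions and of the current state. -/
structure Policy where
  rule (k : ℕ) : Kernel ((Fin k → D.State × D.Action) × D.State) D.Action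
  markov (k : ℕ) : IsMarkovKernel (rule k)

attribute [instance] Policy.markov

variable {D}

namespace Policy

/-- The law of the first state-action pair. -/
def initLaw (π : D.Policy) : Measure (D.State × D.Action) :=
  D.stateLaw ⊗ₘ (π.rule 0).comap (fun w => (Fin.elim0, w)) (by fun_prop)

/-- The conditional law of the state-action pair number `n + 1`, given those up to number `n`: the
state is drawn afresh, and then the action is drawn according to the policy. -/
def stepKernel (π : D.Policy) (n : ℕ) :
    Kernel ((i : Finset.Iic n) → D.State × D.Action) (D.State × D.Action) :=
  Kernel.const _ D.stateLaw ⊗ₖ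
    (π.rule (n + 1)).comap
      (fun p => (fun i : Fin (n + 1) =>
        p.1 ⟨i, Finset.mem_Iic.2 (Nat.lt_succ_iff.1 i.isLt)⟩, p.2))
      (by fun_prop)

instance (π : D.Policy) : IsProbabilityMeasure π.initLaw := by
  unfold initLaw; infer_instance

instance (π : D.Policy) (n : ℕ) : IsMarkovKernel (π.stepKernel n) := by
  unfold stepKernel; infer_instance

/-- The law, under the policy `π`, of the whole sequence of state-action pairs. -/
def law (π : D.Policy) : Measure (ℕ → D.State × D.Action) :=
  Kernel.trajMeasure (X := fun _ => D.State × D.Action) π.initLaw π.stepKernel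

/-- The deterministic stationary Markov policy that takes the action `μ w` in each state `w`. -/
def stationary (μ : D.State → D.Action) (hμ : Measurable μ) : D.Policy where
  rule _ := Kernel.deterministic (fun p => μ p.2) (hμ.comp measurable_snd)
  markov _ := inferInstance

end Policy

/-- The distance in steps from the sink to the `n`-th relay (the sink itself for `n = 0`). -/
def position (ω : ℕ → D.State × D.Action) (n : ℕ) : ℕ :=
  ∑ i ∈ Finset.range n, hopLength (ω i).2

/-- The number `N_x` of relays placed up to `x` steps from the sink. (Each hop has at least one
step, so that only the relays number `1, …, x` can be that close.) -/
def numRelays (ω : ℕ → D.State × D.Action) (x : ℕ) : ℕ :=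
  ((Finset.Icc 1 x).filter fun n => position ω n ≤ x).card

/-- The cost of the network deployed up to `x` steps from the sink. -/
def networkCost (ω : ℕ → D.State × D.Action) (x : ℕ) : ℝ :=
  ∑ i ∈ Finset.range (numRelays ω x), hopCost (ω i).1 (ω i).2

/-- The long-run expected average cost per step of a policy. (`networkCost · x` is a bounded
measurable function, so that the integral is a true expectation.) -/
def averageCost (π : D.Policy) : EReal :=
  limsup (fun x : ℕ => (((∫ ω, networkCost ω x ∂π.law) / x : ℝ) : EReal)) atTop

variable (D) in
/-- The optimal average cost per step, over all policies. -/
def optimalCost : EReal := ⨅ π : D.Policy, averageCost π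

/-- In each state `w`, the action `μ w = (u, γ)` minimizes
`γ + ξ_out Q_out(u, γ, w_u) + ξ_relay - lam * u` over all actions. -/
def IsOptExploreLim (lam : ℝ) (μ : D.State → D.Action) : Prop :=
  ∀ (w : D.State) (a : D.Action),
    hopCost w (μ w) - lam * hopLength (μ w) ≤ hopCost w a - lam * hopLength a

end ExploreForward

end

/-!
Fix `lam` and call `hopCost w a - lam * hopLength a` the relative cost of a hop. Its minimum over the
actions, averaged over the states, is a continuous function of `lam`, nonnegative at `0` and
nonpositive at any upper bound of the hop costs, so it vanishes for some `lam ≥ 0`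
(`exists_integral_minRelCost_eq_zero`).

For this `lam`, consider all hops that start within `x` steps of the sink, that is, the hops number
`0, …, N_x`. Whether the hop number `i` is among them is decided by the hops before it, while the
next state is independent of these. Hence each term contributes a nonnegative expected relative
cost (`integral_startedSum_nonneg`), whatever the policy, and exactly zero if the policy minimizes the
relative cost in every state. This is Wald's identity for the stopping time `N_x + 1`. The lengths
of these hops add up to a number between `x` and `x + A + B`, and all but the last one are counted in
the network cost, so that the expected network cost is at least `lam * x - C` under every policy and
at most `lam * x + lam * (A + B)` under a minimizing one. Dividing by `x` identifies `lam` with the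
optimal average cost.
-/

namespace ExploreForward

variable {D : ExploreForward}

instance : Nonempty D.Action :=
  ⟨⟨⟨D.A + 1, Finset.mem_Icc.2 ⟨le_rfl, by have := D.B_pos; omega⟩⟩,
    ⟨_, D.powers_nonempty.choose_spec⟩⟩⟩

/-! ### Hop lengths and hop costs -/

lemma one_le_hopLength (a : D.Action) : 1 ≤ hopLength a := by
  have := (Finset.mem_Icc.1 a.1.2).1
  unfold hopLength
  omega

lemma hopLength_le (a : D.Action) : hopLength a ≤ D.A + D.B :=
  (Finset.mem_Icc.1 a.1.2).2

lemma hopCost_nonneg (w : D.State) (a : D.Action) : 0 ≤ hopCost w a :=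
  add_nonneg (add_nonneg (D.powers_nonneg _ a.2.2) (mul_nonneg D.xiOut_nonneg measureReal_nonneg))
    D.xiRelay_nonneg

variable (D) in
/-- An upper bound of the hop costs; the sum of all powers bounds each of them. -/
noncomputable def costBound : ℝ := ∑ p ∈ D.powers, p + D.xiOut + D.xiRelay

lemma hopCost_le (w : D.State) (a : D.Action) : hopCost w a ≤ D.costBound := by
  have h1 : (a.2 : ℝ) ≤ ∑ p ∈ D.powers, p :=
    Finset.single_le_sum (f := fun p : ℝ => p) D.powers_nonneg a.2.2
  have h2 : D.xiOut * D.outage a.1 a.2 (w a.1) ≤ D.xiOut :=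
    mul_le_of_le_one_right D.xiOut_nonneg measureReal_le_one
  unfold hopCost costBound
  linarith

lemma costBound_nonneg : 0 ≤ D.costBound :=
  add_nonneg (add_nonneg (Finset.sum_nonneg D.powers_nonneg) D.xiOut_nonneg) D.xiRelay_nonneg

lemma measurable_outage (u : ℕ) (γ : ℝ) : Measurable (D.outage u γ) := by
  have hs : MeasurableSet {p : ℝ × ℝ | D.rcvPower u γ p.1 p.2 ≤ D.minRcvPower} := by
    unfold rcvPower
    exact measurableSet_le (by fun_prop) measurable_const
  exact (measurable_measure_prodMk_left (ν := D.fadingLaw) hs).ennreal_toReal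

lemma measurable_hopCost : Measurable fun p : D.State × D.Action => hopCost p.1 p.2 := by
  refine measurable_from_prod_countable_left fun a => ?_
  have h : Measurable fun w : D.State => D.outage a.1 a.2 (w a.1) :=
    (measurable_outage _ _).comp (measurable_subtype_coe.comp (measurable_pi_apply _))
  exact ((h.const_mul D.xiOut).const_add (a.2 : ℝ)).add_const D.xiRelay

lemma measurable_hopLength : Measurable (hopLength : D.Action → ℕ) := .of_discrete

/-! ### The relative cost and its minimum -/

/-- The cost of the action `p.2` in the state `p.1`, relative to a price `lam` per step. -/
noncomputable def relCost (lam : ℝ) (p : D.State × D.Action) : ℝ :=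
  hopCost p.1 p.2 - lam * hopLength p.2

/-- The minimal relative cost over all actions in a given state. -/
noncomputable def minRelCost (lam : ℝ) (w : D.State) : ℝ :=
  Finset.univ.inf' Finset.univ_nonempty fun a : D.Action => relCost lam (w, a)

lemma measurable_relCost (lam : ℝ) : Measurable (relCost (D := D) lam) := by
  have h : Measurable fun p : D.State × D.Action => (hopLength p.2 : ℝ) :=
    measurable_from_top.comp (measurable_hopLength.comp measurable_snd)
  exact measurable_hopCost.sub (h.const_mul lam)

lemma abs_relCost_le (lam : ℝ) (p : D.State × D.Action) :
    |relCost lam p| ≤ D.costBound + |lam| * (D.A + D.B : ℕ) := by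
  have h1 : |hopCost p.1 p.2| ≤ D.costBound := by
    rw [abs_of_nonneg (hopCost_nonneg _ _)]
    exact hopCost_le _ _
  have h2 : |lam * hopLength p.2| ≤ |lam| * (D.A + D.B : ℕ) := by
    rw [abs_mul, Nat.abs_cast]
    gcongr
    exact hopLength_le _
  exact (abs_sub _ _).trans (add_le_add h1 h2)

lemma minRelCost_le (lam : ℝ) (w : D.State) (a : D.Action) :
    minRelCost lam w ≤ relCost lam (w, a) :=
  Finset.inf'_le _ (Finset.mem_univ a)

lemma exists_minRelCost_eq (lam : ℝ) (w : D.State) :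
    ∃ a : D.Action, minRelCost lam w = relCost lam (w, a) := by
  obtain ⟨a, -, ha⟩ := Finset.exists_mem_eq_inf' Finset.univ_nonempty
    fun a : D.Action => relCost lam (w, a)
  exact ⟨a, ha⟩

lemma abs_minRelCost_le (lam : ℝ) (w : D.State) :
    |minRelCost lam w| ≤ D.costBound + |lam| * (D.A + D.B : ℕ) := by
  obtain ⟨a, ha⟩ := exists_minRelCost_eq lam w
  rw [ha]
  exact abs_relCost_le _ _

lemma IsOptExploreLim.relCost_eq {lam : ℝ} {μ : D.State → D.Action} (h : IsOptExploreLim lam μ)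
    (w : D.State) : relCost lam (w, μ w) = minRelCost lam w :=
  le_antisymm (Finset.le_inf' _ _ fun a _ => h w a) (minRelCost_le _ _ _)

/-- Finitely many measurable cost functions admit a measurable choice of a minimizing index: the
indices are inserted one at a time, each replacing the previous choice where it is no worse. -/
lemma exists_measurable_isOptExploreLim (lam : ℝ) :
    ∃ μ : D.State → D.Action, Measurable μ ∧ IsOptExploreLim lam μ := by
  suffices h : ∀ s : Finset D.Action, s.Nonempty → ∃ μ : D.State → D.Action, Measurable μ ∧
      ∀ w, ∀ a ∈ s, relCost lam (w, μ w) ≤ relCost lam (w, a) by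
    obtain ⟨μ, hμ, h⟩ := h Finset.univ Finset.univ_nonempty
    exact ⟨μ, hμ, fun w a => h w a (Finset.mem_univ a)⟩
  intro s hs
  induction hs using Finset.Nonempty.cons_induction with
  | singleton a => exact ⟨fun _ => a, measurable_const, by simp⟩
  | cons a s ha hs ih =>
    obtain ⟨μ, hμ, h⟩ := ih
    classical
    refine ⟨fun w => if relCost lam (w, a) ≤ relCost lam (w, μ w) then a else μ w,
      Measurable.ite (measurableSet_le ((measurable_relCost lam).comp (by fun_prop))
        ((measurable_relCost lam).comp (by fun_prop))) measurable_const hμ, fun w b hb => ?_⟩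
    rcases Finset.mem_cons.1 hb with rfl | hb
    · dsimp only
      split_ifs with hle
      · exact le_rfl
      · exact (not_le.1 hle).le
    · dsimp only
      split_ifs with hle
      · exact hle.trans (h w b hb)
      · exact h w b hb

lemma measurable_minRelCost (lam : ℝ) : Measurable (minRelCost (D := D) lam) := by
  obtain ⟨μ, hμ, hopt⟩ := exists_measurable_isOptExploreLim (D := D) lam
  rw [← funext hopt.relCost_eq]
  exact (measurable_relCost lam).comp (measurable_id.prodMk hμ)

lemma exists_integral_minRelCost_eq_zero :
    ∃ lam : ℝ, 0 ≤ lam ∧ ∫ w, minRelCost lam w ∂D.stateLaw = 0 := by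
  have hcont : ContinuousOn (fun lam => ∫ w, minRelCost lam w ∂D.stateLaw)
      (Set.Icc 0 D.costBound) := by
    refine continuousOn_of_dominated
      (bound := fun _ => D.costBound + D.costBound * (D.A + D.B : ℕ))
      (fun lam _ => (measurable_minRelCost lam).aestronglyMeasurable) (fun lam hlam => ?_)
      (integrable_const _) (ae_of_all _ fun w => Continuous.continuousOn ?_)
    · refine ae_of_all _ fun w => (abs_minRelCost_le lam w).trans ?_
      rw [abs_of_nonneg hlam.1]
      gcongr
      exact hlam.2
    · unfold minRelCost relCost
      exact Continuous.finset_inf'_apply _ fun a _ => by fun_prop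
  have h0 : 0 ≤ ∫ w, minRelCost 0 w ∂D.stateLaw := by
    refine integral_nonneg fun w => Finset.le_inf' _ _ fun a _ => ?_
    simpa [relCost] using hopCost_nonneg w a
  have hC : ∫ w, minRelCost D.costBound w ∂D.stateLaw ≤ 0 := by
    refine integral_nonpos fun w => ?_
    obtain ⟨a⟩ : Nonempty D.Action := inferInstance
    have h1 : (1 : ℝ) ≤ hopLength a := by exact_mod_cast one_le_hopLength a
    have h2 := hopCost_le w a
    have h3 := le_mul_of_one_le_right (costBound_nonneg (D := D)) h1
    have h4 := minRelCost_le D.costBound w a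
    simp only [relCost] at h4
    simp only [Pi.zero_apply]
    linarith
  obtain ⟨lam, hlam, h⟩ := intermediate_value_Icc' costBound_nonneg hcont ⟨hC, h0⟩
  exact ⟨lam, hlam.1, h⟩

/-! ### Positions and numbers of relays along a trajectory -/

lemma position_strictMono (ω : ℕ → D.State × D.Action) : StrictMono (position ω) :=
  strictMono_nat_of_lt_succ fun n => by
    have := one_le_hopLength (ω n).2
    simp only [position, Finset.sum_range_succ]
    omega

lemma position_le_iff (ω : ℕ → D.State × D.Action) (x n : ℕ) :
    position ω n ≤ x ↔ n ≤ numRelays ω x := by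
  have hmono := position_strictMono ω
  unfold numRelays
  constructor
  · intro h
    calc n = (Finset.Icc 1 n).card := by simp
      _ ≤ _ := Finset.card_le_card fun m hm => by
        have h1 := Finset.mem_Icc.1 hm
        have h2 := hmono.monotone h1.2
        have h3 := hmono.le_apply (x := n)
        exact Finset.mem_filter.2 ⟨Finset.mem_Icc.2 ⟨h1.1, by omega⟩, by omega⟩
  · intro h
    by_contra! hx
    have hn : n ≠ 0 := by
      rintro rfl
      simp [position] at hx
    have : ((Finset.Icc 1 x).filter fun m => position ω m ≤ x).card ≤
        (Finset.Icc 1 (n - 1)).card := Finset.card_le_card fun m hm => by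
      have h1 := Finset.mem_filter.1 hm
      have h2 := hmono.lt_iff_lt.1 (h1.2.trans_lt hx)
      exact Finset.mem_Icc.2 ⟨(Finset.mem_Icc.1 h1.1).1, by omega⟩
    rw [Nat.card_Icc] at this
    omega

lemma numRelays_le (ω : ℕ → D.State × D.Action) (x : ℕ) : numRelays ω x ≤ x :=
  (Finset.card_filter_le _ _).trans (by simp)

/-- The sum of `F` over the hops that start within `x` steps of the sink. -/
noncomputable def startedSum (F : D.State × D.Action → ℝ) (x : ℕ)
    (ω : ℕ → D.State × D.Action) : ℝ :=
  ∑ i ∈ Finset.range (x + 1), if position ω i ≤ x then F (ω i) else 0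

lemma startedSum_eq (F : D.State × D.Action → ℝ) (x : ℕ) (ω : ℕ → D.State × D.Action) :
    startedSum F x ω = ∑ i ∈ Finset.range (numRelays ω x + 1), F (ω i) := by
  rw [startedSum, ← Finset.sum_filter]
  congr 1
  ext i
  have := numRelays_le ω x
  simp only [Finset.mem_filter, Finset.mem_range, position_le_iff]
  omega

lemma networkCost_eq (ω : ℕ → D.State × D.Action) (x : ℕ) :
    networkCost ω x = ∑ i ∈ Finset.range x,
      if position ω (i + 1) ≤ x then hopCost (ω i).1 (ω i).2 else 0 := by
  rw [networkCost, ← Finset.sum_filter]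
  congr 1
  ext i
  have := numRelays_le ω x
  simp only [Finset.mem_filter, Finset.mem_range, position_le_iff]
  omega

lemma startedSum_relCost (lam : ℝ) (x : ℕ) (ω : ℕ → D.State × D.Action) :
    startedSum (relCost lam) x ω = networkCost ω x
      + hopCost (ω (numRelays ω x)).1 (ω (numRelays ω x)).2
      - lam * position ω (numRelays ω x + 1) := by
  rw [startedSum_eq, networkCost, ← Finset.sum_range_succ
    (fun i => hopCost (ω i).1 (ω i).2), position, Nat.cast_sum, Finset.mul_sum,
    ← Finset.sum_sub_distrib]
  rfl

lemma le_networkCost {lam : ℝ} (hlam : 0 ≤ lam) (x : ℕ) (ω : ℕ → D.State × D.Action) :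
    startedSum (relCost lam) x ω + (lam * x - D.costBound) ≤ networkCost ω x := by
  have h1 : x < position ω (numRelays ω x + 1) := by
    by_contra! h
    have := (position_le_iff ω x _).1 h
    omega
  have h2 : lam * x ≤ lam * position ω (numRelays ω x + 1) := by gcongr
  have h3 := hopCost_le (ω (numRelays ω x)).1 (ω (numRelays ω x)).2
  rw [startedSum_relCost]
  linarith

lemma networkCost_le {lam : ℝ} (hlam : 0 ≤ lam) (x : ℕ) (ω : ℕ → D.State × D.Action) :
    networkCost ω x ≤ startedSum (relCost lam) x ω + (lam * x + lam * (D.A + D.B : ℕ)) := by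
  have h1 : position ω (numRelays ω x + 1) ≤ x + (D.A + D.B) := by
    have h1 := (position_le_iff ω x _).2 le_rfl
    have h2 := hopLength_le (ω (numRelays ω x)).2
    unfold position at h1 ⊢
    rw [Finset.sum_range_succ]
    omega
  have h2 : lam * position ω (numRelays ω x + 1) ≤ lam * (x + (D.A + D.B) : ℕ) := by gcongr
  have h3 := hopCost_nonneg (ω (numRelays ω x)).1 (ω (numRelays ω x)).2
  rw [startedSum_relCost]
  push_cast at h2 ⊢
  linarith

/-! ### The law of a policy -/

lemma measurable_position (n : ℕ) :
    Measurable fun ω : ℕ → D.State × D.Action => position ω n :=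
  Finset.measurable_sum _ fun i _ =>
    measurable_hopLength.comp (measurable_snd.comp (measurable_pi_apply i))

namespace Policy

instance (π : D.Policy) : IsProbabilityMeasure π.law := by
  unfold law; infer_instance

/-- The law of the state-action pair at the decision instant `k`, given the past. -/
noncomputable def decisionLaw (π : D.Policy) (k : ℕ) (past : Fin k → D.State × D.Action) :
    Measure (D.State × D.Action) :=
  D.stateLaw ⊗ₘ (π.rule k).comap (fun w => (past, w)) (by fun_prop)

instance (π : D.Policy) (k : ℕ) (past : Fin k → D.State × D.Action) :
    IsProbabilityMeasure (π.decisionLaw k past) := by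
  unfold decisionLaw; infer_instance

lemma stepKernel_apply (π : D.Policy) (n : ℕ) (h : (i : Finset.Iic n) → D.State × D.Action) :
    π.stepKernel n h = π.decisionLaw (n + 1)
      (fun i => h ⟨i, Finset.mem_Iic.2 (Nat.lt_succ_iff.1 i.isLt)⟩) := by
  rw [stepKernel, Kernel.compProd_apply_eq_compProd_sectR]
  rfl

lemma map_law_zero (π : D.Policy) : π.law.map (fun ω => ω 0) = π.initLaw := by
  have h : π.law.map (Preorder.frestrictLe 0) =
      π.initLaw.map (MeasurableEquiv.piUnique _).symm := by
    rw [law, Kernel.trajMeasure, Measure.map_comp _ _ (by fun_prop),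
      Kernel.traj_map_frestrictLe, Kernel.partialTraj_self, Measure.id_comp]
  have h2 := congrArg (Measure.map fun p => p ⟨0, Finset.mem_Iic.2 le_rfl⟩) h
  rw [Measure.map_map (by fun_prop) (by fun_prop),
    Measure.map_map (by fun_prop) (by fun_prop)] at h2
  refine Eq.trans ?_ (h2.trans ?_)
  · rfl
  · exact Measure.map_id

lemma map_law_succ (π : D.Policy) (n : ℕ) :
    π.law.map (fun ω => (Preorder.frestrictLe (π := fun _ => D.State × D.Action) n ω, ω (n + 1))) =
      π.law.map (Preorder.frestrictLe (π := fun _ => D.State × D.Action) n) ⊗ₘ π.stepKernel n :=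
  Kernel.map_frestrictLe_trajMeasure_compProd_eq_map_trajMeasure.symm

lemma integrable_ite_position (π : D.Policy) {F : D.State × D.Action → ℝ} (hF : Measurable F)
    {C : ℝ} (hC : ∀ p, |F p| ≤ C) (x m n : ℕ) :
    Integrable (fun ω => if position ω m ≤ x then F (ω n) else 0) π.law := by
  have hC0 : 0 ≤ C := (abs_nonneg _).trans (hC (π.law.nonempty_of_neZero.some 0))
  refine Integrable.of_bound (Measurable.ite
    (measurableSet_le (measurable_position m) measurable_const) (hF.comp (measurable_pi_apply n))
    measurable_const).aestronglyMeasurable C (ae_of_all _ fun ω => ?_)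
  rw [Real.norm_eq_abs]
  split_ifs
  · exact hC _
  · simpa

/-- The event that the hop number `n` starts within `x` steps depends on the previous hops only, so
that conditioning on them leaves the conditional expectation of `F`, which is nonnegative. -/
lemma integral_ite_position_nonneg (π : D.Policy) {F : D.State × D.Action → ℝ}
    (hF : Measurable F) {C : ℝ} (hC : ∀ p, |F p| ≤ C)
    (hπ : ∀ k past, 0 ≤ ∫ p, F p ∂π.decisionLaw k past) (x n : ℕ) :
    0 ≤ ∫ ω, (if position ω n ≤ x then F (ω n) else 0) ∂π.law := by
  cases n with
  | zero =>
    simp only [position, Finset.range_zero, Finset.sum_empty, zero_le, if_true]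
    rw [← integral_map (φ := fun ω : ℕ → D.State × D.Action => ω 0)
      (measurable_pi_apply 0).aemeasurable
      hF.aestronglyMeasurable, map_law_zero]
    exact hπ 0 Fin.elim0
  | succ n =>
    let pos : ((i : Finset.Iic n) → D.State × D.Action) → ℕ := fun h =>
      ∑ i : Finset.Iic n, hopLength (h i).2
    have hpos : Measurable pos := Finset.measurable_sum _ fun i _ =>
      measurable_hopLength.comp (measurable_snd.comp (measurable_pi_apply i))
    have hpos_eq (ω : ℕ → D.State × D.Action) :
        position ω (n + 1) = pos (Preorder.frestrictLe n ω) := by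
      simp only [position, pos, Preorder.frestrictLe_apply]
      rw [Finset.sum_coe_sort (Finset.Iic n) fun i => hopLength (ω i).2]
      congr 1
      ext i
      simp
    let f : ((i : Finset.Iic n) → D.State × D.Action) × (D.State × D.Action) → ℝ := fun q =>
      if pos q.1 ≤ x then F q.2 else 0
    have hf : Measurable f := Measurable.ite
      (measurableSet_le (hpos.comp measurable_fst) measurable_const) (hF.comp measurable_snd)
      measurable_const
    have hC0 : 0 ≤ C := (abs_nonneg _).trans (hC (π.law.nonempty_of_neZero.some 0))
    have key : ∫ ω, (if position ω (n + 1) ≤ x then F (ω (n + 1)) else 0) ∂π.law =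
        ∫ q, f q ∂(π.law.map (Preorder.frestrictLe n) ⊗ₘ π.stepKernel n) := by
      rw [← map_law_succ, integral_map (by fun_prop) hf.aestronglyMeasurable]
      simp only [hpos_eq, f]
    have : IsProbabilityMeasure (π.law.map
        (Preorder.frestrictLe (π := fun _ => D.State × D.Action) n)) :=
      Measure.isProbabilityMeasure_map (by fun_prop)
    rw [key, Measure.integral_compProd (Integrable.of_bound hf.aestronglyMeasurable C
      (ae_of_all _ fun q => ?_))]
    · refine integral_nonneg fun h => ?_
      simp only [f, Pi.zero_apply]
      split_ifs
      · rw [stepKernel_apply]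
        exact hπ _ _
      · simp
    · simp only [f, Real.norm_eq_abs]
      split_ifs
      · exact hC _
      · simpa

lemma integrable_startedSum (π : D.Policy) {F : D.State × D.Action → ℝ} (hF : Measurable F)
    {C : ℝ} (hC : ∀ p, |F p| ≤ C) (x : ℕ) : Integrable (startedSum F x) π.law :=
  integrable_finsetSum _ fun i _ => π.integrable_ite_position hF hC x i i

lemma integral_startedSum_nonneg (π : D.Policy) {F : D.State × D.Action → ℝ} (hF : Measurable F)
    {C : ℝ} (hC : ∀ p, |F p| ≤ C) (hπ : ∀ k past, 0 ≤ ∫ p, F p ∂π.decisionLaw k past) (x : ℕ) :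
    0 ≤ ∫ ω, startedSum F x ω ∂π.law := by
  unfold startedSum
  rw [integral_finsetSum _ fun i _ => π.integrable_ite_position hF hC x i i]
  exact Finset.sum_nonneg fun i _ => π.integral_ite_position_nonneg hF hC hπ x i

lemma integrable_networkCost (π : D.Policy) (x : ℕ) :
    Integrable (fun ω => networkCost ω x) π.law := by
  simp only [networkCost_eq]
  refine integrable_finsetSum _ fun i _ => π.integrable_ite_position measurable_hopCost
    (C := D.costBound) (fun p => ?_) x (i + 1) i
  rw [abs_of_nonneg (hopCost_nonneg _ _)]
  exact hopCost_le _ _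

lemma integral_minRelCost_le (π : D.Policy) (lam : ℝ) (k : ℕ)
    (past : Fin k → D.State × D.Action) :
    ∫ w, minRelCost lam w ∂D.stateLaw ≤ ∫ p, relCost lam p ∂π.decisionLaw k past := by
  have h : ∫ w, minRelCost lam w ∂D.stateLaw =
      ∫ p, minRelCost lam p.1 ∂π.decisionLaw k past := by
    rw [← integral_map (φ := Prod.fst) (by fun_prop)
      (measurable_minRelCost lam).aestronglyMeasurable]
    congr 1
    exact (Measure.fst_compProd _ _).symm
  rw [h]
  refine integral_mono
    (Integrable.of_bound ((measurable_minRelCost lam).comp measurable_fst).aestronglyMeasurable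
      _ (ae_of_all _ fun p => abs_minRelCost_le lam p.1))
    (Integrable.of_bound (measurable_relCost lam).aestronglyMeasurable
      _ (ae_of_all _ fun p => abs_relCost_le lam p))
    fun p => minRelCost_le lam p.1 p.2

lemma integral_relCost_stationary {lam : ℝ} {μ : D.State → D.Action} (hμ : Measurable μ)
    (hopt : IsOptExploreLim lam μ) (k : ℕ) (past : Fin k → D.State × D.Action) :
    ∫ p, relCost lam p ∂(stationary μ hμ).decisionLaw k past =
      ∫ w, minRelCost lam w ∂D.stateLaw := by
  have hint : Integrable (relCost lam) ((stationary μ hμ).decisionLaw k past) :=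
    Integrable.of_bound (measurable_relCost lam).aestronglyMeasurable
      _ (ae_of_all _ fun p => abs_relCost_le lam p)
  unfold decisionLaw at hint ⊢
  rw [Measure.integral_compProd hint]
  refine integral_congr_ae (ae_of_all _ fun w => ?_)
  simp only [stationary, Kernel.comap_apply, Kernel.deterministic_apply, integral_dirac]
  exact hopt.relCost_eq w

lemma le_integral_networkCost (π : D.Policy) {lam : ℝ} (hlam : 0 ≤ lam)
    (h0 : ∫ w, minRelCost lam w ∂D.stateLaw = 0) (x : ℕ) :
    lam * x - D.costBound ≤ ∫ ω, networkCost ω x ∂π.law := by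
  have hint := π.integrable_startedSum (measurable_relCost lam) (abs_relCost_le lam) x
  have h1 := π.integral_startedSum_nonneg (measurable_relCost lam) (abs_relCost_le lam)
    (fun k past => h0 ▸ π.integral_minRelCost_le lam k past) x
  have h2 := integral_mono (hint.add (integrable_const _)) (π.integrable_networkCost x)
    fun ω => le_networkCost hlam x ω
  simp only [Pi.add_apply] at h2
  rw [integral_add hint (integrable_const _), integral_const, probReal_univ, one_smul] at h2
  linarith

lemma integral_networkCost_stationary_le {lam : ℝ} (hlam : 0 ≤ lam)
    (h0 : ∫ w, minRelCost lam w ∂D.stateLaw = 0) {μ : D.State → D.Action} (hμ : Measurable μ)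
    (hopt : IsOptExploreLim lam μ) (x : ℕ) :
    ∫ ω, networkCost ω x ∂(stationary μ hμ).law ≤ lam * x + lam * (D.A + D.B : ℕ) := by
  have hint := (stationary μ hμ).integrable_startedSum (measurable_relCost lam)
    (abs_relCost_le lam) x
  -- The expectation is zero; the half that is needed is the nonnegativity for `-relCost lam`.
  have h1 := (stationary μ hμ).integral_startedSum_nonneg (measurable_relCost lam).neg
    (fun p => (abs_neg (relCost lam p)).trans_le (abs_relCost_le lam p))
    (fun k past => by
      simp only [Pi.neg_apply]
      rw [integral_neg, integral_relCost_stationary hμ hopt, h0, neg_zero]) x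
  have h2 : (fun ω => startedSum (-relCost (D := D) lam) x ω) =
      fun ω => -startedSum (relCost lam) x ω := by
    funext ω
    simp only [startedSum_eq, Pi.neg_apply, Finset.sum_neg_distrib]
  rw [h2, integral_neg] at h1
  have h3 := integral_mono ((stationary μ hμ).integrable_networkCost x)
    (hint.add (integrable_const _)) fun ω => networkCost_le hlam x ω
  simp only [Pi.add_apply] at h3
  rw [integral_add hint (integrable_const _), integral_const, probReal_univ, one_smul] at h3
  linarith

end Policy

/-! ### Average costs -/

lemma tendsto_affine_div (a b : ℝ) :
    Tendsto (fun x : ℕ => (((a * x + b) / x : ℝ) : EReal)) atTop (nhds (a : EReal)) := by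
  refine (continuous_coe_real_ereal.tendsto a).comp ?_
  have h : Tendsto (fun x : ℕ => a + b / (x : ℝ)) atTop (nhds a) := by
    simpa using (tendsto_const_div_atTop_nhds_zero_nat b).const_add a
  refine h.congr' ?_
  filter_upwards [eventually_gt_atTop 0] with x hx
  have : (x : ℝ) ≠ 0 := by positivity
  field_simp

lemma le_averageCost {lam : ℝ} (hlam : 0 ≤ lam)
    (h0 : ∫ w, minRelCost lam w ∂D.stateLaw = 0) (π : D.Policy) :
    (lam : EReal) ≤ averageCost π := by
  rw [← (tendsto_affine_div lam (-D.costBound)).limsup_eq]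
  refine limsup_le_limsup (Eventually.of_forall fun x => EReal.coe_le_coe_iff.2 ?_)
  gcongr
  exact π.le_integral_networkCost hlam h0 x

lemma averageCost_stationary_le {lam : ℝ} (hlam : 0 ≤ lam)
    (h0 : ∫ w, minRelCost lam w ∂D.stateLaw = 0) {μ : D.State → D.Action} (hμ : Measurable μ)
    (hopt : IsOptExploreLim lam μ) : averageCost (Policy.stationary μ hμ) ≤ lam := by
  rw [← (tendsto_affine_div lam (lam * (D.A + D.B : ℕ))).limsup_eq]
  refine limsup_le_limsup (Eventually.of_forall fun x => EReal.coe_le_coe_iff.2 ?_)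
  gcongr
  exact Policy.integral_networkCost_stationary_le hlam h0 hμ hopt x

end ExploreForward

theorem theorem3 (D : ExploreForward) :
    ∃ lam : ℝ, D.optimalCost = (lam : EReal) ∧
      (∃ μ : D.State → D.Action, Measurable μ ∧ ExploreForward.IsOptExploreLim lam μ) ∧
      ∀ (μ : D.State → D.Action) (hμ : Measurable μ), ExploreForward.IsOptExploreLim lam μ →
        ExploreForward.averageCost (ExploreForward.Policy.stationary μ hμ) = D.optimalCost := by
  obtain ⟨lam, hlam, h0⟩ := ExploreForward.exists_integral_minRelCost_eq_zero (D := D)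
  obtain ⟨μ, hμ, hopt⟩ := ExploreForward.exists_measurable_isOptExploreLim (D := D) lam
  have hle : (lam : EReal) ≤ D.optimalCost :=
    le_iInf fun π => ExploreForward.le_averageCost hlam h0 π
  refine ⟨lam, le_antisymm ?_ hle, ⟨μ, hμ, hopt⟩, fun ν hν hν' => le_antisymm ?_ (iInf_le _ _)⟩
  · exact (iInf_le _ _).trans (ExploreForward.averageCost_stationary_le hlam h0 hμ hopt)
  · exact (ExploreForward.averageCost_stationary_le hlam h0 hν hν').trans hle
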